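/- A map $\mathcal A:U\to V$ of complex vector spaces is semilinear if it is additive and $\mathcal A(\alpha u)=\bar\alpha\,\mathcal A u$; its matrix $A$ in given bases is defined by $[\mathcal A u]=\overline{A[u]}$. A biquiver $Q$ is a finite directed graph (loops and multiple arrows allowed) with vertices $1,\dots,t$ and with full arrows $i\to j$ and dashed arrows $i\dashrightarrow j$. A representation $\mathcal R$ of $Q$ assigns to each vertex $i$ a finite-dimensional complex vector space $\mathcal R_i$, to each full arrow a linear map, and to each dashed arrow a semilinear map between the corresponding spaces; two representations are isomorphic if linear bijections between the spaces at each vertex intertwine the maps of all arrows. Two pairs of $n\times n$ matrices are consimilar if $\bar S^{-1}(A_1,A_2)S=(B_1,B_2)$ for some nonsingular $S$. Theorem 2. The problem of classifying pairs of semilinear operators contains the problem of classifying representations of any biquiver $Q$, in the following sense. Let $n(i)$ be the number of arrows leaving or entering the vertex $i$, loops being counted twice. Choose pairwise distinct positive integers $p_1,\dots,p_t$. For each arrow $\alpha$ from $i$ to $j$, choose a position at the intersection of substrip $k_\alpha$ ($1\le k_\alpha\le p_j$) of the $j$th horizontal strip and substrip $l_\alpha$ ($1\le l_\alpha\le p_i$)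 of the $i$th vertical strip, so that different arrows use different horizontal substrips and different vertical substrips, $k_\alpha$ is even if $\alpha$ is full and odd if $\alpha$ is dashed, and $l_\alpha$ is odd. Such a choice of positions exists whenever $p_i\ge 2n(i)$ for all $i$, and pairwise distinct positive $p_i$ with this property exist. For every family $R=(R_\alpha)$ of $q_j\times q_i$ complex matrices (one for each arrow $\alpha$ from $i$ to $j$), let $$J_q=J_{p_1}(0_{q_1})\oplus\dots\oplus J_{p_t}(0_{q_t}),$$ where $J_p(0_q)$ is the $p\times p$ block matrix with $q\times q$ blocks that has identity blocks on the first superdiagonal and zero blocks elsewhere, and let $M_R$ be the block matrix, partitioned like $J_q$ into $t$ strips of which the $i$th consists of $p_i$ substrips of size $q_i$, with subblock $R_\alpha$ at the position chosen for $\alpha$, for every $\alpha$, and zeros elsewhere. Then for every such choice of the $p_i$ and of the positions: (a) for all $q_1,\dots,q_t\ge 0$ and all families $R,R'$ of matrices of these sizes, the pairs $(J_q,M_R)$ and $(J_q,M_{R'})$ are consimilar if and only if there exist nonsingular matrices $S_1,\dots,S_t$ such that $R'_\alpha=S_j^{-1}R_\alpha S_i$ for every full arrow $\alpha:i\to j$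 and $R'_\alpha=\bar S_j^{-1}R_\alpha S_i$ for every dashed arrow $\alpha:i\dashrightarrow j$; (b) for all representations $\mathcal R,\mathcal R'$ of $Q$ of dimensions $q=(q_i)$ and $q'=(q'_i)$, with matrices $R$ and $R'$ in arbitrary bases of their spaces, $\mathcal R$ and $\mathcal R'$ are isomorphic if and only if the pair of semilinear operators with matrices $(J_q,M_R)$ is isomorphic to the pair of semilinear operators with matrices $(J_{q'},M_{R'})$, that is, a linear bijection between the spaces intertwines both operators. -/

import Mathlib

open Module

universe u v w

noncomputable section

/-- The two kinds of arrows of a biquiver. -/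
inductive ArrowKind where
  | full
  | dashed

/-- The ring endomorphism of `ℂ` along which a mapping of the given kind is semilinear:
the identity for full arrows (linear mappings), complex conjugation for dashed arrows
(semilinear mappings). -/
def ArrowKind.twist : ArrowKind → (ℂ →+* ℂ)
  | .full => RingHom.id ℂ
  | .dashed => starRingEnd ℂ

/-- A biquiver with vertex set `V` and arrow set `A`: a directed graph (loops and multiple
arrows allowed) in which every arrow is either full or dashed. -/
structure Biquiver (V : Type u) (A : Type v) where
  src : A → V
  tgt : A → V
  kind : A → ArrowKind

namespace Biquiver

variable {V : Type u} {A : Type v}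

/-- A representation of a biquiver: a complex vector space at every vertex, a linear mapping
for every full arrow, a semilinear mapping for every dashed arrow. -/
structure Rep (Q : Biquiver V A) where
  space : V → Type w
  [addCommGroup : ∀ i, AddCommGroup (space i)]
  [module : ∀ i, Module ℂ (space i)]
  map : ∀ α : A, space (Q.src α) →ₛₗ[(Q.kind α).twist] space (Q.tgt α)

attribute [instance] Rep.addCommGroup Rep.module

/-- Two representations are isomorphic if there are linear bijections between the spaces at
each vertex that intertwine the mappings of all arrows. -/
def Rep.Isomorphic {Q : Biquiver V A} (R R' : Q.Rep) : Prop :=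
  ∃ φ : ∀ i, R.space i ≃ₗ[ℂ] R'.space i,
    ∀ (α : A) (x : R.space (Q.src α)), φ (Q.tgt α) (R.map α x) = R'.map α (φ (Q.src α) x)

/-- A representation given by matrices: a matrix `q j × q i` for every arrow from `i` to `j`. -/
abbrev MatRep (Q : Biquiver V A) (q : V → ℕ) :=
  ∀ α : A, Matrix (Fin (q (Q.tgt α))) (Fin (q (Q.src α))) ℂ

/-- The matrices of a representation in given bases. A linear mapping `f` has the matrix `F`
with `[f x] = F [x]`; a semilinear mapping `f` has the matrix `F` with `[f x] = conj (F [x])`, so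
that its columns are the conjugates of the coordinate vectors of the images of the basis vectors. -/
def Rep.toMatRep {Q : Biquiver V A} (R : Q.Rep) {q : V → ℕ}
    (b : ∀ i, Basis (Fin (q i)) ℂ (R.space i)) : Q.MatRep q :=
  fun α => Matrix.of fun r s =>
    (Q.kind α).twist ((b (Q.tgt α)).repr (R.map α (b (Q.src α) s)) r)

/-- Equivalence of matrix representations under change of bases: for nonsingular `S i`,
`R' α = (S j)⁻¹ * R α * S i` for a full arrow `α` from `i` to `j`, and
`R' α = (conj (S j))⁻¹ * R α * S i` for a dashed one. -/
def MatRep.Equivalent {Q : Biquiver V A} {q : V → ℕ} (R R' : Q.MatRep q) : Prop :=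
  ∃ S : ∀ i, Matrix (Fin (q i)) (Fin (q i)) ℂ, (∀ i, IsUnit (S i)) ∧
    ∀ α : A, ((S (Q.tgt α)).map (Q.kind α).twist)⁻¹ * R α * S (Q.src α) = R' α

/-- The number of arrows leaving or entering the vertex `i`, loops being counted twice. -/
def valency (Q : Biquiver V A) [Fintype A] [DecidableEq V] (i : V) : ℕ :=
  (Finset.univ.filter fun α => Q.src α = i).card + (Finset.univ.filter fun α => Q.tgt α = i).card

/-- A choice, for every arrow `α` from `i` to `j`, of a position in a block matrix whose
`i`-th strip is divided into `p i` substrips: the horizontal substrip `row α` of the `j`-th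
horizontal strip and the vertical substrip `col α` of the `i`-th vertical strip. Different arrows
use different horizontal substrips and different vertical substrips. Counted from `1`, the number
of the horizontal substrip is even for full arrows and odd for dashed ones, and the number of the
vertical substrip is odd. (Elements of `Fin` are counted from `0`.) -/
structure Layout (Q : Biquiver V A) (p : V → ℕ) where
  row : ∀ α : A, Fin (p (Q.tgt α))
  col : ∀ α : A, Fin (p (Q.src α))
  row_injective : Function.Injective
    fun α : A => (⟨Q.tgt α, row α⟩ : Σ j : V, Fin (p j))
  col_injective : Function.Injective
    fun α : A => (⟨Q.src α, col α⟩ : Σ i : V, Fin (p i))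
  row_full : ∀ α : A, Q.kind α = ArrowKind.full → Even ((row α : ℕ) + 1)
  row_dashed : ∀ α : A, Q.kind α = ArrowKind.dashed → Odd ((row α : ℕ) + 1)
  col_odd : ∀ α : A, Odd ((col α : ℕ) + 1)

end Biquiver

/-- Row and column numbers of block matrices whose `i`-th strip is divided into `p i` substrips
of size `q i`. -/
abbrev BlockIndex {V : Type u} (p q : V → ℕ) := Σ i : V, Fin (p i) × Fin (q i)

/-- `J_p(0_q)`: the block matrix with `p × p` blocks of size `q × q`, with identity blocks on the
first superdiagonal and zero blocks elsewhere. -/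
def nilpotentBlock (p q : ℕ) : Matrix (Fin p × Fin q) (Fin p × Fin q) ℂ :=
  Matrix.of fun x y => if (x.1 : ℕ) + 1 = (y.1 : ℕ) ∧ x.2 = y.2 then 1 else 0

/-- The direct sum of the matrices `J_{p i}(0_{q i})`. -/
def matrixJ {V : Type u} [DecidableEq V] (p q : V → ℕ) :
    Matrix (BlockIndex p q) (BlockIndex p q) ℂ :=
  Matrix.blockDiagonal' fun i => nilpotentBlock (p i) (q i)

/-- The block matrix, partitioned like `matrixJ p q`, whose subblock at the position chosen for
the arrow `α` is `R α`, for every `α`, and whose other subblocks are zero. -/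
def Biquiver.Layout.matrixM {V : Type u} {A : Type v} [DecidableEq V] [Fintype A]
    {Q : Biquiver V A} {p : V → ℕ} (L : Q.Layout p) {q : V → ℕ} (R : Q.MatRep q) :
    Matrix (BlockIndex p q) (BlockIndex p q) ℂ :=
  ∑ α : A, ∑ r : Fin (q (Q.tgt α)), ∑ s : Fin (q (Q.src α)),
    Matrix.single (⟨Q.tgt α, L.row α, r⟩ : BlockIndex p q)
      (⟨Q.src α, L.col α, s⟩ : BlockIndex p q) (R α r s)

/-- Consimilarity of the matrix pairs `(A₁, A₂)` and `(B₁, B₂)`. -/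
def ConsimilarPairs {n : Type*} [Fintype n] [DecidableEq n] (A₁ A₂ B₁ B₂ : Matrix n n ℂ) : Prop :=
  ∃ S : Matrix n n ℂ, IsUnit S ∧
    (S.map (starRingEnd ℂ))⁻¹ * A₁ * S = B₁ ∧ (S.map (starRingEnd ℂ))⁻¹ * A₂ * S = B₂

/-- The semilinear operator on `ℂⁿ` with matrix `A` in the standard basis: `x ↦ conj (A x)`. -/
def semilinearOfMatrix {n : Type*} [Fintype n] (A : Matrix n n ℂ) :
    (n → ℂ) →ₛₗ[starRingEnd ℂ] (n → ℂ) where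
  toFun x := fun i => starRingEnd ℂ (A.mulVec x i)
  map_add' x y := by
    ext i
    simp [Matrix.mulVec_add]
  map_smul' c x := by
    ext i
    simp [Matrix.mulVec_smul]

/-- Isomorphism of the pairs `(f₁, f₂)` and `(g₁, g₂)` of semilinear operators. -/
def IsomorphicPairs {U W : Type*} [AddCommGroup U] [Module ℂ U] [AddCommGroup W] [Module ℂ W]
    (f₁ f₂ : U →ₛₗ[starRingEnd ℂ] U) (g₁ g₂ : W →ₛₗ[starRingEnd ℂ] W) : Prop :=
  ∃ φ : U ≃ₗ[ℂ] W, (∀ x, φ (f₁ x) = g₁ (φ x)) ∧ (∀ x, φ (f₂ x) = g₂ (φ x))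

end

/-!
# Pairs of semilinear operators contain the representations of every biquiver

Every notion of equivalence in the theorem is translated into the existence of mutually inverse
matrices `S`, `T`, possibly rectangular, that intertwine the given matrices. Consimilarity of
`(A₁, A₂)` with `(B₁, B₂)` becomes `conj S * B = A * S`, isomorphism of pairs of semilinear
operators is the same relation in coordinates (`semilinear_intertwine_iff`), and both sides of the
theorem become statements about `IsomorphicMatrixPairs` and `Biquiver.MatRep.Isomorphic`. Admitting
rectangular matrices treats representations of different dimensions along with the others.

A matrix `S` with `conj S * J = J * S` is rigid. Comparing entries, every block of `S` is the
conjugate of its neighbour up and to the left, so the blocks are constant up to conjugation along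
the diagonals of each pair of strips, and a diagonal vanishes if it starts at the left border below
the corner or ends at the lower border before the corner. Hence a block of `S` in the strips `i`,
`j` and the substrips `a`, `b` vanishes unless `b - a ≥ max 0 (p j - p i)`. As the `p i` are
distinct, `S` is block triangular when the substrips are ordered by `a` and then by decreasing
`p i`. For mutually inverse `S` and `T` the diagonal blocks at the first substrip of strip `i` are
therefore mutually inverse (`mul_apply_first_of_matrixJ`); this is how the matrices `S i` arise, and
why the dimensions agree. The other diagonal blocks of strip `i` are `conj (S i), S i, …`.

The subblock at the position of an arrow `α` is the only nonzero one in its horizontal and in its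
vertical substrip of `M`. So in `conj S * M_R = M_R' * S` the subblock at this position involves
only diagonal blocks of `S`, and the parities of the position make it the relation required of
`S i` for the arrow `α`. Conversely, the block diagonal matrix with the blocks
`S i, conj (S i), S i, …` (`alternatingDiagonal`) intertwines both pairs.
-/

/-! ### Semilinear mappings in coordinates -/

/-- Linear bijections intertwine two semilinear mappings if and only if their matrices satisfy the
corresponding matrix identity. The matrix of a `σ`-semilinear mapping `f` is, as in
`Biquiver.Rep.toMatRep`, the matrix `F` with `[f x] = σ (F [x])`. -/
theorem semilinear_intertwine_iff {σ : ℂ →+* ℂ} (hσ : ∀ z, σ (σ z) = z)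
    {m n m' n' : Type*} [Fintype m] [Fintype n] [Fintype m'] [Fintype n']
    [DecidableEq m] [DecidableEq n]
    {U W U' W' : Type*} [AddCommGroup U] [Module ℂ U] [AddCommGroup W] [Module ℂ W]
    [AddCommGroup U'] [Module ℂ U'] [AddCommGroup W'] [Module ℂ W']
    (b : Basis n ℂ U) (c : Basis m ℂ W) (b' : Basis n' ℂ U') (c' : Basis m' ℂ W')
    (f : U →ₛₗ[σ] W) (f' : U' →ₛₗ[σ] W') (φ : U →ₗ[ℂ] U') (ψ : W →ₗ[ℂ] W') :
    (∀ x, ψ (f x) = f' (φ x)) ↔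
      (LinearMap.toMatrix c c' ψ).map σ * Matrix.of (fun r s => σ (c.repr (f (b s)) r)) =
        Matrix.of (fun r s => σ (c'.repr (f' (b' s)) r)) * LinearMap.toMatrix b b' φ := by
  have hl : ∀ r s, ((LinearMap.toMatrix c c' ψ).map σ *
      Matrix.of (fun r s => σ (c.repr (f (b s)) r))) r s = σ (c'.repr (ψ (f (b s))) r) := by
    intro r s
    rw [← congrFun (LinearMap.toMatrix_mulVec_repr c c' ψ (f (b s))) r]
    simp [Matrix.mul_apply, Matrix.mulVec, dotProduct]
  have hr : ∀ r s, (Matrix.of (fun r s => σ (c'.repr (f' (b' s)) r)) *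
      LinearMap.toMatrix b b' φ) r s = σ (c'.repr (f' (φ (b s))) r) := by
    intro r s
    conv_rhs => rw [← b'.sum_repr (φ (b s)), map_sum, map_sum]
    simp only [Finsupp.finsetSum_apply, map_sum, Matrix.mul_apply]
    refine Finset.sum_congr rfl fun k _ => ?_
    rw [f'.map_smulₛₗ, map_smul, Finsupp.smul_apply, smul_eq_mul, map_mul, hσ, mul_comm,
      LinearMap.toMatrix_apply, Matrix.of_apply]
  constructor
  · intro h
    ext r s
    rw [hl, hr, h]
  · intro h
    have key : ψ.comp f = f'.comp φ := by
      refine b.ext fun s => c'.repr.injective (Finsupp.ext fun r => ?_)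
      have := congrFun (congrFun h r) s
      rw [hl, hr] at this
      simpa [hσ] using congrArg σ this
    exact fun x => LinearMap.congr_fun key x

theorem ArrowKind.twist_twist (k : ArrowKind) (z : ℂ) : k.twist (k.twist z) = z := by
  cases k <;> simp [ArrowKind.twist]

/-! ### Intertwining matrices of arbitrary sizes -/

/-- Isomorphism of matrix representations that may have different dimensions: mutually inverse
rectangular matrices at every vertex that intertwine the matrices of all arrows. -/
def Biquiver.MatRep.Isomorphic {V : Type u} {A : Type v} {Q : Biquiver V A} {q q' : V → ℕ}
    (R : Q.MatRep q) (R' : Q.MatRep q') : Prop :=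
  ∃ (S : ∀ i, Matrix (Fin (q' i)) (Fin (q i)) ℂ) (T : ∀ i, Matrix (Fin (q i)) (Fin (q' i)) ℂ),
    (∀ i, S i * T i = 1) ∧ (∀ i, T i * S i = 1) ∧
      ∀ α, (S (Q.tgt α)).map (Q.kind α).twist * R α = R' α * S (Q.src α)

/-- The pairs of matrices of isomorphic pairs of semilinear operators, on spaces whose coordinates
may be indexed differently. For square matrices this is consimilarity. -/
def IsomorphicMatrixPairs {n m : Type*} [Fintype n] [DecidableEq n] [Fintype m] [DecidableEq m]
    (A₁ A₂ : Matrix n n ℂ) (B₁ B₂ : Matrix m m ℂ) : Prop :=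
  ∃ (S : Matrix m n ℂ) (T : Matrix n m ℂ), S * T = 1 ∧ T * S = 1 ∧
    S.map (starRingEnd ℂ) * A₁ = B₁ * S ∧ S.map (starRingEnd ℂ) * A₂ = B₂ * S

theorem Matrix.isUnit_map {n : Type*} [Fintype n] [DecidableEq n] (σ : ℂ →+* ℂ)
    {S : Matrix n n ℂ} (hS : IsUnit S) : IsUnit (S.map σ) :=
  hS.map σ.mapMatrix

/-- A twisted similarity `σ(S)⁻¹ A S = B` is an intertwining relation from `B` to `A`. -/
theorem Matrix.inv_map_mul_mul_eq_iff {m n : Type*} [Fintype n] [Fintype m] [DecidableEq m]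
    (σ : ℂ →+* ℂ) {S : Matrix m m ℂ} (hS : IsUnit S) (T : Matrix n n ℂ) (A B : Matrix m n ℂ) :
    (S.map σ)⁻¹ * A * T = B ↔ S.map σ * B = A * T := by
  have hdet := (Matrix.isUnit_iff_isUnit_det _).1 (Matrix.isUnit_map σ hS)
  constructor
  · rintro rfl
    rw [Matrix.mul_assoc, Matrix.mul_nonsing_inv_cancel_left _ _ hdet]
  · intro h
    rw [Matrix.mul_assoc, ← h, Matrix.nonsing_inv_mul_cancel_left _ _ hdet]

theorem consimilarPairs_iff {n : Type*} [Fintype n] [DecidableEq n] (A₁ A₂ B₁ B₂ : Matrix n n ℂ) :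
    ConsimilarPairs A₁ A₂ B₁ B₂ ↔ IsomorphicMatrixPairs B₁ B₂ A₁ A₂ := by
  constructor
  · rintro ⟨S, hS, h₁, h₂⟩
    have hdet := (Matrix.isUnit_iff_isUnit_det _).1 hS
    exact ⟨S, S⁻¹, Matrix.mul_nonsing_inv _ hdet, Matrix.nonsing_inv_mul _ hdet,
      (Matrix.inv_map_mul_mul_eq_iff _ hS _ _ _).1 h₁,
      (Matrix.inv_map_mul_mul_eq_iff _ hS _ _ _).1 h₂⟩
  · rintro ⟨S, T, hST, hTS, h₁, h₂⟩
    have hS : IsUnit S := ⟨⟨S, T, hST, hTS⟩, rfl⟩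
    exact ⟨S, hS, (Matrix.inv_map_mul_mul_eq_iff _ hS _ _ _).2 h₁,
      (Matrix.inv_map_mul_mul_eq_iff _ hS _ _ _).2 h₂⟩

theorem Biquiver.MatRep.equivalent_iff {V : Type u} {A : Type v} {Q : Biquiver V A} {q : V → ℕ}
    (R R' : Q.MatRep q) : R.Equivalent R' ↔ R'.Isomorphic R := by
  constructor
  · rintro ⟨S, hS, h⟩
    have hdet := fun i => (Matrix.isUnit_iff_isUnit_det _).1 (hS i)
    exact ⟨S, fun i => (S i)⁻¹, fun i => Matrix.mul_nonsing_inv _ (hdet i),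
      fun i => Matrix.nonsing_inv_mul _ (hdet i),
      fun α => (Matrix.inv_map_mul_mul_eq_iff _ (hS _) _ _ _).1 (h α)⟩
  · rintro ⟨S, T, hST, hTS, h⟩
    have hS : ∀ i, IsUnit (S i) := fun i => ⟨⟨S i, T i, hST i, hTS i⟩, rfl⟩
    exact ⟨S, hS, fun α => (Matrix.inv_map_mul_mul_eq_iff _ (hS _) _ _ _).2 (h α)⟩

/-- The linear bijection given in bases by mutually inverse matrices. -/
noncomputable def linearEquivOfMatrices {m n : Type*} [Fintype m] [Fintype n] [DecidableEq m]
    [DecidableEq n] {U W : Type*} [AddCommGroup U] [Module ℂ U] [AddCommGroup W] [Module ℂ W]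
    (b : Basis n ℂ U) (c : Basis m ℂ W) (S : Matrix m n ℂ) (T : Matrix n m ℂ)
    (hST : S * T = 1) (hTS : T * S = 1) : U ≃ₗ[ℂ] W :=
  LinearEquiv.ofLinearMap (Matrix.toLin b c S) (Matrix.toLin c b T)
    (by rw [← Matrix.toLin_mul, hST, Matrix.toLin_one])
    (by rw [← Matrix.toLin_mul, hTS, Matrix.toLin_one])

theorem toMatrix_linearEquivOfMatrices {m n : Type*} [Fintype m] [Fintype n] [DecidableEq m]
    [DecidableEq n] {U W : Type*} [AddCommGroup U] [Module ℂ U] [AddCommGroup W] [Module ℂ W]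
    (b : Basis n ℂ U) (c : Basis m ℂ W) (S : Matrix m n ℂ) (T : Matrix n m ℂ)
    (hST : S * T = 1) (hTS : T * S = 1) :
    LinearMap.toMatrix b c (linearEquivOfMatrices b c S T hST hTS).toLinearMap = S :=
  LinearMap.toMatrix_toLin b c S

theorem LinearEquiv.toMatrix_mul_toMatrix_symm {m n : Type*} [Fintype m] [Fintype n]
    [DecidableEq m] [DecidableEq n] {U W : Type*} [AddCommGroup U] [Module ℂ U] [AddCommGroup W]
    [Module ℂ W] (b : Basis n ℂ U) (c : Basis m ℂ W) (φ : U ≃ₗ[ℂ] W) :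
    LinearMap.toMatrix b c φ.toLinearMap * LinearMap.toMatrix c b φ.symm.toLinearMap = 1 := by
  rw [← LinearMap.toMatrix_comp]
  simp

theorem Biquiver.Rep.isomorphic_iff {V : Type u} {A : Type v} {Q : Biquiver V A}
    (R R' : Biquiver.Rep.{u, v, w} Q) {q q' : V → ℕ}
    (b : ∀ i, Basis (Fin (q i)) ℂ (R.space i)) (b' : ∀ i, Basis (Fin (q' i)) ℂ (R'.space i)) :
    R.Isomorphic R' ↔ (R.toMatRep b).Isomorphic (R'.toMatRep b') := by
  constructor
  · rintro ⟨φ, h⟩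
    exact ⟨fun i => LinearMap.toMatrix (b i) (b' i) (φ i).toLinearMap,
      fun i => LinearMap.toMatrix (b' i) (b i) (φ i).symm.toLinearMap,
      fun i => (φ i).toMatrix_mul_toMatrix_symm (b i) (b' i),
      fun i => (φ i).symm.toMatrix_mul_toMatrix_symm (b' i) (b i),
      fun α => (semilinear_intertwine_iff (Q.kind α).twist_twist (b _) (b _) (b' _) (b' _)
        (R.map α) (R'.map α) (φ _).toLinearMap (φ _).toLinearMap).1 (h α)⟩
  · rintro ⟨S, T, hST, hTS, h⟩
    refine ⟨fun i => linearEquivOfMatrices (b i) (b' i) (S i) (T i) (hST i) (hTS i), fun α =>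
      (semilinear_intertwine_iff (Q.kind α).twist_twist (b _) (b _) (b' _) (b' _)
        (R.map α) (R'.map α) (linearEquivOfMatrices _ _ _ _ (hST _) (hTS _)).toLinearMap
        (linearEquivOfMatrices _ _ _ _ (hST _) (hTS _)).toLinearMap).2 ?_⟩
    rw [toMatrix_linearEquivOfMatrices, toMatrix_linearEquivOfMatrices]
    exact h α

theorem of_semilinearOfMatrix_basisFun {n : Type*} [Fintype n] [DecidableEq n]
    (B : Matrix n n ℂ) :
    Matrix.of (fun r s => starRingEnd ℂ ((Pi.basisFun ℂ n).repr
      (semilinearOfMatrix B (Pi.basisFun ℂ n s)) r)) = B := by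
  ext r s
  simp [semilinearOfMatrix]

theorem semilinearOfMatrix_intertwine_iff {n m : Type*} [Fintype n] [DecidableEq n] [Fintype m]
    [DecidableEq m] (B : Matrix n n ℂ) (C : Matrix m m ℂ) (φ : (n → ℂ) →ₗ[ℂ] (m → ℂ)) :
    (∀ x, φ (semilinearOfMatrix B x) = semilinearOfMatrix C (φ x)) ↔
      (LinearMap.toMatrix (Pi.basisFun ℂ n) (Pi.basisFun ℂ m) φ).map (starRingEnd ℂ) * B =
        C * LinearMap.toMatrix (Pi.basisFun ℂ n) (Pi.basisFun ℂ m) φ := by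
  rw [semilinear_intertwine_iff Complex.conj_conj (Pi.basisFun ℂ n) (Pi.basisFun ℂ n)
    (Pi.basisFun ℂ m) (Pi.basisFun ℂ m), of_semilinearOfMatrix_basisFun,
    of_semilinearOfMatrix_basisFun]

theorem isomorphicPairs_semilinearOfMatrix_iff {n m : Type*} [Fintype n] [DecidableEq n]
    [Fintype m] [DecidableEq m] (A₁ A₂ : Matrix n n ℂ) (B₁ B₂ : Matrix m m ℂ) :
    IsomorphicPairs (semilinearOfMatrix A₁) (semilinearOfMatrix A₂)
      (semilinearOfMatrix B₁) (semilinearOfMatrix B₂) ↔ IsomorphicMatrixPairs A₁ A₂ B₁ B₂ := by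
  constructor
  · rintro ⟨φ, h₁, h₂⟩
    exact ⟨_, _, φ.toMatrix_mul_toMatrix_symm (Pi.basisFun ℂ n) (Pi.basisFun ℂ m),
      φ.symm.toMatrix_mul_toMatrix_symm (Pi.basisFun ℂ m) (Pi.basisFun ℂ n),
      (semilinearOfMatrix_intertwine_iff A₁ B₁ φ.toLinearMap).1 h₁,
      (semilinearOfMatrix_intertwine_iff A₂ B₂ φ.toLinearMap).1 h₂⟩
  · rintro ⟨S, T, hST, hTS, h₁, h₂⟩
    refine ⟨linearEquivOfMatrices (Pi.basisFun ℂ n) (Pi.basisFun ℂ m) S T hST hTS,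
      (semilinearOfMatrix_intertwine_iff A₁ B₁ (linearEquivOfMatrices _ _ S T hST hTS).toLinearMap).2
        ?_,
      (semilinearOfMatrix_intertwine_iff A₂ B₂ (linearEquivOfMatrices _ _ S T hST hTS).toLinearMap).2
        ?_⟩
    · rwa [toMatrix_linearEquivOfMatrices]
    · rwa [toMatrix_linearEquivOfMatrices]

/-! ### Matrices intertwining the nilpotent matrices -/

section Nilpotent

variable {V : Type u} [DecidableEq V] {p q q' : V → ℕ}

theorem matrixJ_apply_eq_zero {i j : V} {a : Fin (p i)} {b : Fin (p j)} {r : Fin (q i)}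
    {s : Fin (q j)} (h : (a : ℕ) + 1 ≠ b ∨
      (⟨i, r⟩ : Σ i, Fin (q i)) ≠ ⟨j, s⟩) :
    matrixJ p q ⟨i, a, r⟩ ⟨j, b, s⟩ = 0 := by
  by_cases hij : i = j
  · subst hij
    rw [matrixJ, Matrix.blockDiagonal'_apply_eq]
    simp only [nilpotentBlock, Matrix.of_apply, ite_eq_right_iff, one_ne_zero, imp_false]
    rintro ⟨h₁, rfl⟩
    simp_all
  · exact Matrix.blockDiagonal'_apply_ne _ _ _ hij

theorem matrixJ_apply_eq_one {i : V} {a b : Fin (p i)} (r : Fin (q i)) (h : (a : ℕ) + 1 = b) :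
    matrixJ p q ⟨i, a, r⟩ ⟨i, b, r⟩ = 1 := by
  rw [matrixJ, Matrix.blockDiagonal'_apply_eq]
  simp [nilpotentBlock, h]

/-- The block diagonal matrix whose diagonal blocks in the `i`-th strip are
`S i, conj (S i), S i, …`. -/
def alternatingDiagonal (p : V → ℕ) (S : ∀ i, Matrix (Fin (q' i)) (Fin (q i)) ℂ) :
    Matrix (BlockIndex p q') (BlockIndex p q) ℂ :=
  Matrix.blockDiagonal' fun i =>
    (Matrix.blockDiagonal fun a : Fin (p i) =>
      (S i).map (starRingEnd ℂ ^ (a : ℕ))).submatrix Prod.swap Prod.swap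

theorem alternatingDiagonal_apply_eq (S : ∀ i, Matrix (Fin (q' i)) (Fin (q i)) ℂ) (i : V)
    (a : Fin (p i)) (r : Fin (q' i)) (s : Fin (q i)) :
    alternatingDiagonal p S ⟨i, a, r⟩ ⟨i, a, s⟩ = (starRingEnd ℂ ^ (a : ℕ)) (S i r s) := by
  simp [alternatingDiagonal, Matrix.blockDiagonal_apply]

theorem alternatingDiagonal_apply_ne (S : ∀ i, Matrix (Fin (q' i)) (Fin (q i)) ℂ) {i j : V}
    {a : Fin (p i)} {b : Fin (p j)} (h : i ≠ j ∨ (a : ℕ) ≠ b) (r : Fin (q' i)) (s : Fin (q j)) :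
    alternatingDiagonal p S ⟨i, a, r⟩ ⟨j, b, s⟩ = 0 := by
  by_cases hij : i = j
  · subst hij
    have : a ≠ b := fun hab => by simp [hab] at h
    simp [alternatingDiagonal, Matrix.blockDiagonal_apply, this]
  · exact Matrix.blockDiagonal'_apply_ne _ _ _ hij

variable [Fintype V]

/-- Right multiplication by `matrixJ` shifts the blocks of every strip one place to the right. -/
theorem mul_matrixJ_apply_succ {n : Type*} (N : Matrix n (BlockIndex p q) ℂ) (x : n) (j : V)
    (b : ℕ) (hb : b + 1 < p j) (s : Fin (q j)) :
    (N * matrixJ p q) x ⟨j, ⟨b + 1, hb⟩, s⟩ = N x ⟨j, ⟨b, by omega⟩, s⟩ := by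
  rw [Matrix.mul_apply, Finset.sum_eq_single ⟨j, ⟨b, by omega⟩, s⟩]
  · rw [matrixJ_apply_eq_one _ rfl, mul_one]
  · rintro ⟨i, a, r⟩ - hne
    rw [matrixJ_apply_eq_zero, mul_zero]
    by_contra! h
    obtain ⟨h₁, h₂⟩ := h
    cases h₂
    exact hne (by simp [Fin.ext_iff] at h₁ ⊢; omega)
  · simp

theorem mul_matrixJ_apply_zero {n : Type*} (N : Matrix n (BlockIndex p q) ℂ) (x : n) (j : V)
    (hb : 0 < p j) (s : Fin (q j)) :
    (N * matrixJ p q) x ⟨j, ⟨0, hb⟩, s⟩ = 0 := by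
  rw [Matrix.mul_apply, Finset.sum_eq_zero]
  rintro ⟨i, a, r⟩ -
  rw [matrixJ_apply_eq_zero (.inl (by simp)), mul_zero]

/-- Left multiplication by `matrixJ` shifts the blocks of every strip one place up. -/
theorem matrixJ_mul_apply_of_lt {n : Type*} (N : Matrix (BlockIndex p q) n ℂ) (y : n) (i : V)
    (a : ℕ) (ha : a + 1 < p i) (r : Fin (q i)) :
    (matrixJ p q * N) ⟨i, ⟨a, by omega⟩, r⟩ y = N ⟨i, ⟨a + 1, ha⟩, r⟩ y := by
  rw [Matrix.mul_apply, Finset.sum_eq_single ⟨i, ⟨a + 1, ha⟩, r⟩]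
  · rw [matrixJ_apply_eq_one _ rfl, one_mul]
  · rintro ⟨j, b, s⟩ - hne
    rw [matrixJ_apply_eq_zero, zero_mul]
    by_contra! h
    obtain ⟨h₁, h₂⟩ := h
    cases h₂
    exact hne (by simp [Fin.ext_iff] at h₁ ⊢; omega)
  · simp

theorem matrixJ_mul_apply_last {n : Type*} (N : Matrix (BlockIndex p q) n ℂ) (y : n) (i : V)
    (a : ℕ) (ha : a + 1 = p i) (r : Fin (q i)) :
    (matrixJ p q * N) ⟨i, ⟨a, by omega⟩, r⟩ y = 0 := by
  rw [Matrix.mul_apply, Finset.sum_eq_zero]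
  rintro ⟨j, b, s⟩ -
  rw [matrixJ_apply_eq_zero, zero_mul]
  by_contra! h
  obtain ⟨h₁, h₂⟩ := h
  cases h₂
  have := b.isLt
  simp at h₁
  omega

/-- A matrix `S` with `conj S * J = J * S` is constant up to conjugation along the diagonals of
every pair of strips. -/
theorem apply_succ_succ_of_matrixJ {S : Matrix (BlockIndex p q') (BlockIndex p q) ℂ}
    (hS : S.map (starRingEnd ℂ) * matrixJ p q = matrixJ p q' * S) {i j : V} {a b : ℕ}
    (ha : a + 1 < p i) (hb : b + 1 < p j) (r : Fin (q' i)) (s : Fin (q j)) :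
    S ⟨i, ⟨a + 1, ha⟩, r⟩ ⟨j, ⟨b + 1, hb⟩, s⟩ =
      starRingEnd ℂ (S ⟨i, ⟨a, by omega⟩, r⟩ ⟨j, ⟨b, by omega⟩, s⟩) := by
  have h := congrFun (congrFun hS ⟨i, ⟨a, by omega⟩, r⟩) ⟨j, ⟨b + 1, hb⟩, s⟩
  rw [mul_matrixJ_apply_succ, matrixJ_mul_apply_of_lt _ _ _ _ ha] at h
  exact h.symm

/-- The diagonals of a pair of strips that start at the left border below the first substrip
vanish. -/
theorem apply_eq_zero_of_lt_of_matrixJ {S : Matrix (BlockIndex p q') (BlockIndex p q) ℂ}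
    (hS : S.map (starRingEnd ℂ) * matrixJ p q = matrixJ p q' * S) {i j : V} {a b : ℕ}
    (ha : a < p i) (hb : b < p j) (hba : b < a) (r : Fin (q' i)) (s : Fin (q j)) :
    S ⟨i, ⟨a, ha⟩, r⟩ ⟨j, ⟨b, hb⟩, s⟩ = 0 := by
  induction b generalizing a with
  | zero =>
    obtain ⟨a, rfl⟩ : ∃ c, a = c + 1 := ⟨a - 1, by omega⟩
    have h := congrFun (congrFun hS ⟨i, ⟨a, by omega⟩, r⟩) ⟨j, ⟨0, hb⟩, s⟩
    rw [mul_matrixJ_apply_zero, matrixJ_mul_apply_of_lt _ _ _ _ ha] at h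
    exact h.symm
  | succ b ih =>
    obtain ⟨a, rfl⟩ : ∃ c, a = c + 1 := ⟨a - 1, by omega⟩
    rw [apply_succ_succ_of_matrixJ hS, ih (by omega) (by omega) (by omega), map_zero]

/-- The diagonals of a pair of strips that end at the lower border before the last substrip
vanish. -/
theorem apply_eq_zero_of_add_lt_of_matrixJ {S : Matrix (BlockIndex p q') (BlockIndex p q) ℂ}
    (hS : S.map (starRingEnd ℂ) * matrixJ p q = matrixJ p q' * S) {i j : V} {a b : ℕ}
    (ha : a < p i) (hb : b < p j) (hba : b + p i < a + p j) (r : Fin (q' i)) (s : Fin (q j)) :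
    S ⟨i, ⟨a, ha⟩, r⟩ ⟨j, ⟨b, hb⟩, s⟩ = 0 := by
  induction h : p i - 1 - a generalizing a b with
  | zero =>
    have h := congrFun (congrFun hS ⟨i, ⟨a, ha⟩, r⟩) ⟨j, ⟨b + 1, by omega⟩, s⟩
    rw [mul_matrixJ_apply_succ, matrixJ_mul_apply_last _ _ _ _ (by omega), Matrix.map_apply] at h
    exact (map_eq_zero _).1 h
  | succ n ih =>
    have h := ih (a := a + 1) (b := b + 1) (by omega) (by omega) (by omega) (by omega)
    rw [apply_succ_succ_of_matrixJ hS] at h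
    exact (map_eq_zero _).1 h

/-- The diagonal blocks of the `i`-th strip are obtained from the first one by repeated
conjugation. -/
theorem apply_diag_of_matrixJ {S : Matrix (BlockIndex p q') (BlockIndex p q) ℂ}
    (hS : S.map (starRingEnd ℂ) * matrixJ p q = matrixJ p q' * S) {i : V} {a : ℕ}
    (ha : a < p i) (r : Fin (q' i)) (s : Fin (q i)) :
    S ⟨i, ⟨a, ha⟩, r⟩ ⟨i, ⟨a, ha⟩, s⟩ =
      (starRingEnd ℂ ^ a) (S ⟨i, ⟨0, by omega⟩, r⟩ ⟨i, ⟨0, by omega⟩, s⟩) := by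
  induction a with
  | zero => simp
  | succ a ih => rw [apply_succ_succ_of_matrixJ hS, ih (by omega), pow_succ', RingHom.mul_def,
      RingHom.comp_apply]

/-- An entry in a first diagonal block of a product of two matrices intertwining `matrixJ` only
involves first diagonal blocks of the same strip. Blocks of other strips do not contribute because
the strips have different numbers of substrips: one of the two factors vanishes by
`apply_eq_zero_of_add_lt_of_matrixJ`. -/
theorem mul_apply_first_of_matrixJ (hp : Function.Injective p) {q'' : V → ℕ}
    {S : Matrix (BlockIndex p q') (BlockIndex p q) ℂ}
    {T : Matrix (BlockIndex p q) (BlockIndex p q'') ℂ}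
    (hS : S.map (starRingEnd ℂ) * matrixJ p q = matrixJ p q' * S)
    (hT : T.map (starRingEnd ℂ) * matrixJ p q'' = matrixJ p q * T)
    {i : V} (hi : 0 < p i) (r : Fin (q' i)) (s : Fin (q'' i)) :
    (S * T) ⟨i, ⟨0, hi⟩, r⟩ ⟨i, ⟨0, hi⟩, s⟩ =
      ∑ k, S ⟨i, ⟨0, hi⟩, r⟩ ⟨i, ⟨0, hi⟩, k⟩ * T ⟨i, ⟨0, hi⟩, k⟩ ⟨i, ⟨0, hi⟩, s⟩ := by
  rw [Matrix.mul_apply, Fintype.sum_sigma, Finset.sum_eq_single i, Fintype.sum_prod_type,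
    Finset.sum_eq_single ⟨0, hi⟩]
  · rintro ⟨b, hb⟩ - hne
    refine Finset.sum_eq_zero fun k _ => ?_
    rw [apply_eq_zero_of_lt_of_matrixJ hT hb hi (by simp at hne; omega), mul_zero]
  · simp
  · rintro j - hji
    have hpji : p j ≠ p i := fun h => hji (hp h)
    refine Finset.sum_eq_zero ?_
    rintro ⟨⟨b, hb⟩, k⟩ -
    by_cases hb0 : 0 < b
    · rw [apply_eq_zero_of_lt_of_matrixJ hT hb hi hb0, mul_zero]
    obtain rfl : b = 0 := by omega
    rcases lt_or_gt_of_ne hpji with h | h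
    · rw [apply_eq_zero_of_add_lt_of_matrixJ hT hb hi (by omega), mul_zero]
    · rw [apply_eq_zero_of_add_lt_of_matrixJ hS hi hb (by omega), zero_mul]
  · simp

theorem alternatingDiagonal_mul_of_eq_one {S : ∀ i, Matrix (Fin (q' i)) (Fin (q i)) ℂ}
    {T : ∀ i, Matrix (Fin (q i)) (Fin (q' i)) ℂ} (h : ∀ i, S i * T i = 1) :
    alternatingDiagonal p S * alternatingDiagonal p T = 1 := by
  rw [alternatingDiagonal, alternatingDiagonal, ← Matrix.blockDiagonal'_mul,
    ← Matrix.blockDiagonal'_one]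
  congr 1
  funext i
  have hswap : (Prod.swap : Fin (p i) × Fin (q i) → Fin (q i) × Fin (p i)) =
    Equiv.prodComm _ _ := rfl
  rw [hswap, Matrix.submatrix_mul_equiv, ← Matrix.blockDiagonal_mul]
  simp_rw [← Matrix.map_mul, h]
  simp [Matrix.submatrix_one _ Prod.swap_injective, ← Pi.one_def]

theorem alternatingDiagonal_matrixJ (S : ∀ i, Matrix (Fin (q' i)) (Fin (q i)) ℂ) :
    (alternatingDiagonal p S).map (starRingEnd ℂ) * matrixJ p q =
      matrixJ p q' * alternatingDiagonal p S := by
  ext ⟨i, ⟨a, ha⟩, r⟩ ⟨j, ⟨b, hb⟩, s⟩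
  by_cases ha' : a + 1 < p i
  · rw [matrixJ_mul_apply_of_lt _ _ _ _ ha']
    cases b with
    | zero => rw [mul_matrixJ_apply_zero, alternatingDiagonal_apply_ne _ (.inr (by simp))]
    | succ b =>
      rw [mul_matrixJ_apply_succ, Matrix.map_apply]
      by_cases h : i = j ∧ a = b
      · obtain ⟨rfl, rfl⟩ := h
        rw [alternatingDiagonal_apply_eq, alternatingDiagonal_apply_eq, pow_succ']
        rfl
      · rw [alternatingDiagonal_apply_ne, alternatingDiagonal_apply_ne, map_zero] <;>
        · simp only [ne_eq]
          by_contra!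
          exact h (by simpa using this)
  · rw [matrixJ_mul_apply_last _ _ _ _ (by omega)]
    cases b with
    | zero => rw [mul_matrixJ_apply_zero]
    | succ b =>
      rw [mul_matrixJ_apply_succ, Matrix.map_apply, alternatingDiagonal_apply_ne, map_zero]
      by_contra! h
      obtain ⟨rfl, h⟩ := h
      simp only at h
      omega
end Nilpotent

/-! ### The block matrix of a representation -/

section Layout

variable {V : Type u} {A : Type v} [DecidableEq V] {p q q' : V → ℕ}

/-- The matrix of the inclusion of the `a`-th summand of the `i`-th strip. Multiplying by it, or
by its transpose, extracts a vertical, or a horizontal, substrip. -/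
def blockInclusion (p q : V → ℕ) (i : V) (a : Fin (p i)) :
    Matrix (BlockIndex p q) (Fin (q i)) ℂ :=
  (1 : Matrix (BlockIndex p q) (BlockIndex p q) ℂ).submatrix id fun r => ⟨i, a, r⟩

theorem Biquiver.Layout.matrixM_eq_sum [Fintype A] {Q : Biquiver V A} (L : Q.Layout p)
    (R : Q.MatRep q) :
    L.matrixM R = ∑ α, blockInclusion p q (Q.tgt α) (L.row α) * R α *
      (blockInclusion p q (Q.src α) (L.col α)).transpose := by
  refine Finset.sum_congr rfl fun α _ => ?_
  ext x y
  simp only [Matrix.sum_apply, Matrix.mul_apply, Matrix.transpose_apply, blockInclusion,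
    Matrix.submatrix_apply, id, Matrix.one_apply, Matrix.single_apply, Finset.sum_mul]
  rw [Finset.sum_comm]
  refine Finset.sum_congr rfl fun s _ => Finset.sum_congr rfl fun r _ => ?_
  by_cases hx : x = ⟨Q.tgt α, L.row α, r⟩ <;> by_cases hy : y = ⟨Q.src α, L.col α, s⟩ <;>
    simp [hx, hy, eq_comm]

variable [Fintype V]

theorem mul_blockInclusion {n : Type*} (N : Matrix n (BlockIndex p q) ℂ) (i : V) (a : Fin (p i)) :
    N * blockInclusion p q i a = N.submatrix id fun r => ⟨i, a, r⟩ := by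
  ext x r
  simp [blockInclusion, Matrix.mul_apply, Matrix.one_apply]

theorem blockInclusion_transpose_mul {n : Type*} (N : Matrix (BlockIndex p q) n ℂ) (i : V)
    (a : Fin (p i)) :
    (blockInclusion p q i a).transpose * N = N.submatrix (fun r => ⟨i, a, r⟩) id := by
  ext r y
  simp [blockInclusion, Matrix.mul_apply, Matrix.one_apply]

theorem blockInclusion_transpose_mul_self (i : V) (a : Fin (p i)) :
    (blockInclusion p q i a).transpose * blockInclusion p q i a = 1 := by
  rw [blockInclusion_transpose_mul]
  ext r s
  simp [blockInclusion, Matrix.one_apply]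

theorem blockInclusion_transpose_mul_of_ne {i j : V} {a : Fin (p i)} {b : Fin (p j)}
    (h : (⟨i, a⟩ : Σ i, Fin (p i)) ≠ ⟨j, b⟩) :
    (blockInclusion p q i a).transpose * blockInclusion p q j b = 0 := by
  rw [blockInclusion_transpose_mul]
  ext r s
  simp only [blockInclusion, Matrix.submatrix_apply, id, Matrix.one_apply, Matrix.zero_apply,
    ite_eq_right_iff, one_ne_zero, imp_false]
  intro h'
  cases h'
  exact h rfl

theorem alternatingDiagonal_mul_blockInclusion (S : ∀ i, Matrix (Fin (q' i)) (Fin (q i)) ℂ)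
    (i : V) (a : Fin (p i)) :
    alternatingDiagonal p S * blockInclusion p q i a =
      blockInclusion p q' i a * (S i).map (starRingEnd ℂ ^ (a : ℕ)) := by
  rw [mul_blockInclusion]
  ext ⟨j, b, r⟩ s
  by_cases h : j = i ∧ (b : ℕ) = a
  · obtain ⟨rfl, h⟩ := h
    obtain rfl := Fin.ext h
    simp [alternatingDiagonal_apply_eq, blockInclusion, Matrix.mul_apply, Matrix.one_apply]
  · have h' : ∀ k, (⟨j, b, r⟩ : BlockIndex p q') ≠ ⟨i, a, k⟩ := by
      intro k hk
      cases hk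
      exact h ⟨rfl, rfl⟩
    rw [Matrix.submatrix_apply, id, alternatingDiagonal_apply_ne]
    · simp [blockInclusion, Matrix.mul_apply, h']
    · by_contra! h''
      exact h h''

theorem blockInclusion_transpose_mul_alternatingDiagonal
    (S : ∀ i, Matrix (Fin (q' i)) (Fin (q i)) ℂ) (i : V) (a : Fin (p i)) :
    (blockInclusion p q' i a).transpose * alternatingDiagonal p S =
      (S i).map (starRingEnd ℂ ^ (a : ℕ)) * (blockInclusion p q i a).transpose := by
  rw [blockInclusion_transpose_mul]
  ext r ⟨j, b, s⟩
  by_cases h : i = j ∧ (a : ℕ) = b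
  · obtain ⟨rfl, h⟩ := h
    obtain rfl := Fin.ext h
    simp [alternatingDiagonal_apply_eq, blockInclusion, Matrix.mul_apply, Matrix.one_apply]
  · have h' : ∀ k, (⟨j, b, s⟩ : BlockIndex p q) ≠ ⟨i, a, k⟩ := by
      intro k hk
      cases hk
      exact h ⟨rfl, rfl⟩
    rw [Matrix.submatrix_apply, id, alternatingDiagonal_apply_ne]
    · simp [blockInclusion, Matrix.mul_apply, fun k => (h' k).symm]
    · by_contra! h''
      exact h h''

variable [Fintype A] {Q : Biquiver V A} (L : Q.Layout p)

/-- Only the arrow `α` contributes to the vertical substrip `col α`. -/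
theorem Biquiver.Layout.matrixM_mul_blockInclusion (R : Q.MatRep q) (α : A) :
    L.matrixM R * blockInclusion p q (Q.src α) (L.col α) =
      blockInclusion p q (Q.tgt α) (L.row α) * R α := by
  rw [L.matrixM_eq_sum, Matrix.sum_mul, Finset.sum_eq_single α]
  · rw [Matrix.mul_assoc, blockInclusion_transpose_mul_self, Matrix.mul_one]
  · intro β _ hβ
    rw [Matrix.mul_assoc, blockInclusion_transpose_mul_of_ne fun h => hβ (L.col_injective h),
      Matrix.mul_zero]
  · simp

/-- Only the arrow `α` contributes to the horizontal substrip `row α`. -/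
theorem Biquiver.Layout.blockInclusion_transpose_mul_matrixM (R : Q.MatRep q) (α : A) :
    (blockInclusion p q (Q.tgt α) (L.row α)).transpose * L.matrixM R =
      R α * (blockInclusion p q (Q.src α) (L.col α)).transpose := by
  rw [L.matrixM_eq_sum, Matrix.mul_sum, Finset.sum_eq_single α]
  · rw [← Matrix.mul_assoc, ← Matrix.mul_assoc, blockInclusion_transpose_mul_self, Matrix.one_mul]
  · intro β _ hβ
    rw [← Matrix.mul_assoc, ← Matrix.mul_assoc,
      blockInclusion_transpose_mul_of_ne fun h => hβ (L.row_injective h).symm,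
      Matrix.zero_mul, Matrix.zero_mul]
  · simp

end Layout

/-! ### The reduction to pairs of matrices -/

section Reduction

variable {V : Type u} {A : Type v} {Q : Biquiver V A} {p q q' : V → ℕ}

theorem starRingEnd_pow_of_even {n : ℕ} (hn : Even n) :
    starRingEnd ℂ ^ n = RingHom.id ℂ := by
  obtain ⟨k, rfl⟩ := hn
  have h : starRingEnd ℂ * starRingEnd ℂ = 1 :=
    RingHom.ext Complex.conj_conj
  rw [← two_mul, pow_mul, pow_two, h, one_pow]
  rfl

/-- The parities prescribed for the horizontal substrips are those for which conjugating the
diagonal block at the position of an arrow gives the twist of that arrow. -/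
theorem Biquiver.Layout.starRingEnd_pow_row (L : Q.Layout p) (α : A) :
    starRingEnd ℂ ^ ((L.row α : ℕ) + 1) = (Q.kind α).twist := by
  cases h : Q.kind α with
  | full => exact starRingEnd_pow_of_even (L.row_full α h)
  | dashed =>
    have := L.row_dashed α h
    have hrow : Even (L.row α : ℕ) := by grind
    rw [pow_succ, starRingEnd_pow_of_even hrow]
    rfl

theorem Biquiver.Layout.starRingEnd_pow_col (L : Q.Layout p) (α : A) :
    starRingEnd ℂ ^ (L.col α : ℕ) = RingHom.id ℂ := by
  have := L.col_odd α
  exact starRingEnd_pow_of_even (by grind)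

theorem Matrix.map_starRingEnd_pow {m n : Type*} (S : Matrix m n ℂ) (a : ℕ) :
    (S.map (starRingEnd ℂ ^ a)).map (starRingEnd ℂ) = S.map (starRingEnd ℂ ^ (a + 1)) := by
  rw [pow_succ']
  rfl

/-- The inverse of an intertwining matrix intertwines in the opposite direction. -/
theorem Matrix.map_mul_eq_of_mul_eq_one {m n : Type*} [Fintype m] [Fintype n] [DecidableEq m]
    [DecidableEq n] {S : Matrix m n ℂ} {T : Matrix n m ℂ} (hST : S * T = 1) (hTS : T * S = 1)
    {B : Matrix n n ℂ} {C : Matrix m m ℂ} (h : S.map (starRingEnd ℂ) * B = C * S) :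
    T.map (starRingEnd ℂ) * C = B * T := by
  have h' : T.map (starRingEnd ℂ) * S.map (starRingEnd ℂ) = 1 := by
    rw [← Matrix.map_mul, hTS, Matrix.map_one _ (map_zero _) (map_one _)]
  calc T.map (starRingEnd ℂ) * C = T.map (starRingEnd ℂ) * (C * S) * T := by
        rw [Matrix.mul_assoc, Matrix.mul_assoc, hST, Matrix.mul_one]
    _ = B * T := by rw [← h, ← Matrix.mul_assoc, h', Matrix.one_mul]

variable [DecidableEq V] [Fintype V] [Fintype A]

theorem Biquiver.Layout.alternatingDiagonal_matrixM (L : Q.Layout p) {R : Q.MatRep q}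
    {R' : Q.MatRep q'} {S : ∀ i, Matrix (Fin (q' i)) (Fin (q i)) ℂ}
    (hS : ∀ α, (S (Q.tgt α)).map (Q.kind α).twist * R α = R' α * S (Q.src α)) :
    (alternatingDiagonal p S).map (starRingEnd ℂ) * L.matrixM R =
      L.matrixM R' * alternatingDiagonal p S := by
  rw [L.matrixM_eq_sum, L.matrixM_eq_sum, Matrix.mul_sum, Matrix.sum_mul]
  refine Finset.sum_congr rfl fun α _ => ?_
  have hrow : (alternatingDiagonal p S).map (starRingEnd ℂ) *
      blockInclusion p q (Q.tgt α) (L.row α) =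
      blockInclusion p q' (Q.tgt α) (L.row α) * (S (Q.tgt α)).map (Q.kind α).twist := by
    have hincl : ∀ q : V → ℕ, (blockInclusion p q (Q.tgt α) (L.row α)).map (starRingEnd ℂ) =
        blockInclusion p q (Q.tgt α) (L.row α) := fun q => by
      rw [blockInclusion, ← Matrix.submatrix_map, Matrix.map_one _ (map_zero _) (map_one _)]
    have h := congrArg (fun N => N.map (starRingEnd ℂ))
      (alternatingDiagonal_mul_blockInclusion S (Q.tgt α) (L.row α))
    simpa only [Matrix.map_mul, hincl, Matrix.map_starRingEnd_pow, L.starRingEnd_pow_row] using h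
  have hcol : (blockInclusion p q' (Q.src α) (L.col α)).transpose * alternatingDiagonal p S =
      S (Q.src α) * (blockInclusion p q (Q.src α) (L.col α)).transpose := by
    rw [blockInclusion_transpose_mul_alternatingDiagonal, L.starRingEnd_pow_col]
    congr 1
  rw [Matrix.mul_assoc _ _ (alternatingDiagonal p S), hcol, ← Matrix.mul_assoc,
    ← Matrix.mul_assoc, hrow, ← Matrix.mul_assoc, Matrix.mul_assoc _ _ (R α), hS,
    ← Matrix.mul_assoc]

/-- An isomorphism of matrix representations of a biquiver is the same as an isomorphism of the
associated pairs. In one direction the diagonal blocks are repeated with alternating conjugations.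
In the other one the first diagonal blocks of all strips are extracted; the relation for an arrow
`α` is found in the subblock at the position of `α`, where the remaining blocks of an intertwining
matrix do not interfere. -/
theorem Biquiver.Layout.isomorphicMatrixPairs_iff (hp : Function.Injective p)
    (hpos : ∀ i, 0 < p i) (L : Q.Layout p) (R : Q.MatRep q) (R' : Q.MatRep q') :
    IsomorphicMatrixPairs (matrixJ p q) (L.matrixM R) (matrixJ p q') (L.matrixM R') ↔
      R.Isomorphic R' := by
  constructor
  · rintro ⟨S, T, hST, hTS, hJ, hM⟩
    have hJT := Matrix.map_mul_eq_of_mul_eq_one hST hTS hJ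
    refine ⟨fun i => S.submatrix (fun r => ⟨i, ⟨0, hpos i⟩, r⟩) fun s => ⟨i, ⟨0, hpos i⟩, s⟩,
      fun i => T.submatrix (fun r => ⟨i, ⟨0, hpos i⟩, r⟩) fun s => ⟨i, ⟨0, hpos i⟩, s⟩,
      fun i => ?_, fun i => ?_, fun α => ?_⟩
    · ext r s
      rw [Matrix.mul_apply]
      simp only [Matrix.submatrix_apply]
      rw [← mul_apply_first_of_matrixJ hp hJ hJT, hST]
      simp [Matrix.one_apply]
    · ext r s
      rw [Matrix.mul_apply]
      simp only [Matrix.submatrix_apply]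
      rw [← mul_apply_first_of_matrixJ hp hJT hJ, hTS]
      simp [Matrix.one_apply]
    · have hrow : (S.submatrix (fun r => ⟨Q.tgt α, ⟨0, hpos _⟩, r⟩)
          fun s => ⟨Q.tgt α, ⟨0, hpos _⟩, s⟩).map (Q.kind α).twist =
          (blockInclusion p q' (Q.tgt α) (L.row α)).transpose * S.map (starRingEnd ℂ) *
            blockInclusion p q (Q.tgt α) (L.row α) := by
        rw [blockInclusion_transpose_mul, mul_blockInclusion, ← L.starRingEnd_pow_row, pow_succ']
        ext r s
        exact congrArg (starRingEnd ℂ) (apply_diag_of_matrixJ hJ (L.row α).isLt r s).symm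
      have hcol : S.submatrix (fun r => ⟨Q.src α, ⟨0, hpos _⟩, r⟩)
          (fun s => ⟨Q.src α, ⟨0, hpos _⟩, s⟩) =
          (blockInclusion p q' (Q.src α) (L.col α)).transpose * S *
            blockInclusion p q (Q.src α) (L.col α) := by
        rw [blockInclusion_transpose_mul, mul_blockInclusion]
        ext r s
        have h := apply_diag_of_matrixJ hJ (L.col α).isLt r s
        rw [L.starRingEnd_pow_col] at h
        exact h.symm
      dsimp only
      rw [hrow, hcol, Matrix.mul_assoc, ← L.matrixM_mul_blockInclusion, ← Matrix.mul_assoc,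
        Matrix.mul_assoc _ (S.map _), hM, ← Matrix.mul_assoc,
        L.blockInclusion_transpose_mul_matrixM]
      simp only [Matrix.mul_assoc]
  · rintro ⟨S, T, hST, hTS, h⟩
    exact ⟨alternatingDiagonal p S, alternatingDiagonal p T,
      alternatingDiagonal_mul_of_eq_one hST, alternatingDiagonal_mul_of_eq_one hTS,
      alternatingDiagonal_matrixJ S, L.alternatingDiagonal_matrixM h⟩

end Reduction

/-! ### Existence of layouts -/

/-- The elements of each fibre of a map on a finite type can be numbered consecutively from `0`. -/
theorem exists_fibre_numbering {V : Type u} {A : Type v} [DecidableEq V] [Fintype A] (f : A → V) :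
    ∃ c : A → ℕ, (∀ α, c α < (Finset.univ.filter fun β => f β = f α).card) ∧
      ∀ α β, f α = f β → c α = c β → α = β := by
  let e := fun i => (Finset.univ.filter fun β => f β = i).equivFin
  have hmem : ∀ α, α ∈ Finset.univ.filter fun β => f β = f α := fun α => by simp
  refine ⟨fun α => e (f α) ⟨α, hmem α⟩, fun α => (e _ _).isLt, fun α β h hc => ?_⟩
  have key : ∀ i j (hα : α ∈ Finset.univ.filter fun γ => f γ = i)
      (hβ : β ∈ Finset.univ.filter fun γ => f γ = j),
      i = j → (e i ⟨α, hα⟩ : ℕ) = e j ⟨β, hβ⟩ → α = β := by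
    rintro i _ hα hβ rfl h
    exact congrArg Subtype.val ((e i).injective (Fin.ext h))
  exact key _ _ (hmem α) (hmem β) h hc

theorem Biquiver.nonempty_layout {V : Type u} {A : Type v} [DecidableEq V] [Fintype A]
    (Q : Biquiver V A) {p : V → ℕ} (hp : ∀ i, 2 * Q.valency i ≤ p i) : Nonempty (Q.Layout p) := by
  obtain ⟨r, hr, hr_inj⟩ := exists_fibre_numbering Q.tgt
  obtain ⟨c, hc, hc_inj⟩ := exists_fibre_numbering Q.src
  -- The arrow numbered `r α` may use the horizontal substrips `2 * r α` and `2 * r α + 1`,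
  -- counted from `0`; the second one is right for full arrows.
  let ε : ArrowKind → ℕ := fun k => match k with
    | .full => 1
    | .dashed => 0
  have hε : ∀ k, ε k ≤ 1 := fun k => by cases k <;> simp [ε]
  refine ⟨⟨fun α => ⟨2 * r α + ε (Q.kind α), ?_⟩, fun α => ⟨2 * c α, ?_⟩, fun α β h => ?_,
    fun α β h => ?_, fun α h => ?_, fun α h => ?_, fun α => ?_⟩⟩
  · have h₁ := hp (Q.tgt α)
    have h₂ := hr α
    have h₃ := hε (Q.kind α)
    unfold Biquiver.valency at h₁
    omega
  · have h₁ := hp (Q.src α)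
    have h₂ := hc α
    unfold Biquiver.valency at h₁
    omega
  · have h₁ : Q.tgt α = Q.tgt β := congrArg Sigma.fst h
    have h₂ : 2 * r α + ε (Q.kind α) = 2 * r β + ε (Q.kind β) :=
      congrArg (fun x : Σ j : V, Fin (p j) => (x.2 : ℕ)) h
    have h₃ := hε (Q.kind α)
    have h₄ := hε (Q.kind β)
    exact hr_inj α β h₁ (by omega)
  · have h₁ : Q.src α = Q.src β := congrArg Sigma.fst h
    have h₂ : 2 * c α = 2 * c β := congrArg (fun x : Σ i : V, Fin (p i) => (x.2 : ℕ)) h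
    exact hc_inj α β h₁ (by omega)
  · exact ⟨r α + 1, by simp only [ε, h]; ring⟩
  · exact ⟨r α, by simp only [ε, h]; ring⟩
  · exact ⟨c α, rfl⟩

theorem Biquiver.exists_injective_two_mul_valency_le {V : Type u} {A : Type v} [Fintype V]
    [DecidableEq V] [Fintype A] (Q : Biquiver V A) :
    ∃ p : V → ℕ, Function.Injective p ∧ (∀ i, 0 < p i) ∧ ∀ i, 2 * Q.valency i ≤ p i := by
  refine ⟨fun i => 2 * ∑ j, Q.valency j + 1 + Fintype.equivFin V i, fun i j h => ?_,
    fun i => by positivity, fun i => ?_⟩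
  · exact (Fintype.equivFin V).injective (Fin.ext (by simpa using h))
  · have := Finset.single_le_sum (f := Q.valency) (fun _ _ => Nat.zero_le _) (Finset.mem_univ i)
    dsimp only
    omega

theorem theorem2 {V : Type u} {A : Type v} [Fintype V] [DecidableEq V] [Fintype A]
    (Q : Biquiver V A) :
    -- suitable numbers of substrips exist, and they always admit a layout
    (∃ p : V → ℕ, Function.Injective p ∧ (∀ i, 0 < p i) ∧ ∀ i, 2 * Q.valency i ≤ p i) ∧
    (∀ p : V → ℕ, (∀ i, 2 * Q.valency i ≤ p i) → Nonempty (Q.Layout p)) ∧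
    -- every layout reduces the classification of representations to that of pairs
    ∀ p : V → ℕ, Function.Injective p → (∀ i, 0 < p i) → ∀ L : Q.Layout p,
      -- for matrices
      (∀ (q : V → ℕ) (R R' : Q.MatRep q),
        ConsimilarPairs (matrixJ p q) (L.matrixM R) (matrixJ p q) (L.matrixM R') ↔
          R.Equivalent R') ∧
      -- for representations and semilinear operators, in any bases and any finite dimensions
      (∀ (R R' : Biquiver.Rep.{u, v, w} Q) (q q' : V → ℕ)
        (b : ∀ i, Module.Basis (Fin (q i)) ℂ (R.space i))
        (b' : ∀ i, Module.Basis (Fin (q' i)) ℂ (R'.space i)),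
        IsomorphicPairs
            (semilinearOfMatrix (matrixJ p q)) (semilinearOfMatrix (L.matrixM (R.toMatRep b)))
            (semilinearOfMatrix (matrixJ p q')) (semilinearOfMatrix (L.matrixM (R'.toMatRep b'))) ↔
          R.Isomorphic R') := by
  refine ⟨Q.exists_injective_two_mul_valency_le, fun p hp => Q.nonempty_layout hp,
    fun p hp hpos L => ⟨fun q R R' => ?_, fun R R' q q' b b' => ?_⟩⟩
  · rw [consimilarPairs_iff, L.isomorphicMatrixPairs_iff hp hpos, R.equivalent_iff]
  · rw [isomorphicPairs_semilinearOfMatrix_iff, L.isomorphicMatrixPairs_iff hp hpos,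
      R.isomorphic_iff R' b b']
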